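/- Let $R$ be a nonzero commutative ring, let $n,t\ge 1$ be integers, and let $\Omega=R[x_1,\dots,x_n]$. For $f\in\Omega$ and $\beta\in\mathbb{N}^n$ let $f_{[\beta]}$ denote the coefficient of $\prod_i x_i^{\beta_i}$ in $f$. For each $k\in\{1,\dots,n\}$ let $S_k$ be a finite subset of $R$, let $E_k\subseteq S_k$, and let $\psi_k$ assign a positive integer $\psi_k(u)$ to each $u\in S_k$. Put $$g_k=\prod_{u\in S_k}(x_k-u)^{\psi_k(u)},\qquad h_k=\prod_{u\in E_k}(x_k-u)^{\psi_k(u)},\qquad e=\min_{1\le k\le n}\ \sum_{u\in S_k}\psi_k(u).$$ As $h_k$ is monic and divides $g_k$, there is a unique $g_k/h_k\in\Omega$ with $(g_k/h_k)\,h_k=g_k$. For $s\in\mathbb{N}$ and $p_1,\dots,p_n\in\Omega$ let $\mathcal{I}_s(p_1,\dots,p_n)$ be the ideal of $\Omega$ generated by all products $\prod_{k=1}^n p_k^{\alpha_k}$ with $\alpha\in\mathbb{N}^n$, $\sum_i\alpha_i=s$. Let $Q$ be the set of all $f\in\Omega$ such that (i) $f(x_1+a_1,\dots,x_n+a_n)_{[\beta]}=0$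 for all $a\in\prod_{i=1}^n S_i\setminus\prod_{i=1}^n E_i$ and $\beta\in\mathbb{N}^n$ with $\sum_{i=1}^n\lfloor\beta_i/\psi_i(a_i)\rfloor\le t-1$; (ii) $f(x_1+a_1,\dots,x_n+a_n)_{[\beta]}=0$ for all $a\in\prod_{i=1}^n E_i$ and $\beta\in\mathbb{N}^n$ with $\sum_{i=1}^n\lfloor\beta_i/\psi_i(a_i)\rfloor\le t-2$. Suppose that every $S_k$ satisfies Condition (D): for all $a\neq b$ in $S_k$, the element $b-a$ is not a zero divisor of $R$ (that is, $(b-a)w=0$ implies $w=0$). Then: (1) $Q=\Big(\bigcap_{m=1}^n\mathcal{I}_t(g_1,\dots,g_{m-1},g_m/h_m,g_{m+1},\dots,g_n)\Big)\cap\mathcal{I}_{t-1}(h_1,\dots,h_n)$. (2) $Q=\mathcal{I}_t(g_1,\dots,g_n)+\mathcal{I}_{t-1}(g_1,\dots,g_n)\cdot\prod_{i=1}^n\frac{g_i}{h_i}$. (3) For every $f\in Q$: $f\notin\mathcal{I}_t(g_1,\dots,g_n)$ if and only if there exist $v\in\prod_{i=1}^n E_i$ and $\gamma\in\mathbb{N}^n$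 with $\sum_{i=1}^n\lfloor\gamma_i/\psi_i(v_i)\rfloor=t-1$ and $f(x_1+v_1,\dots,x_n+v_n)_{[\gamma]}\neq0$. (4) If $\prod_{i=1}^n E_i\neq\emptyset$, then for every $\gamma\in\mathbb{N}^n$ with $\sum_i\gamma_i=t-1$ the polynomial $\big(\prod_{i=1}^n g_i^{\gamma_i}\big)\prod_{i=1}^n\frac{g_i}{h_i}$ lies in $Q\setminus\mathcal{I}_t(g_1,\dots,g_n)$; moreover $$\min\{\deg f\mid f\in Q\setminus\mathcal{I}_t(g_1,\dots,g_n)\}=(t-1)e+\sum_{i=1}^n\ \sum_{u\in S_i\setminus E_i}\psi_i(u),$$ where $\deg$ is the total degree. -/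

import Mathlib

namespace PuncturedNull

open MvPolynomial

variable {R : Type*} [CommRing R] {n : ℕ}

/-- Condition (D): differences of distinct elements of `X` are not zero divisors of `R`. Here `u` is
a zero divisor if `u * w = 0` for some `w ≠ 0`. -/
def ConditionD (X : Set R) : Prop :=
  ∀ a ∈ X, ∀ b ∈ X, a ≠ b → ¬ ∃ w : R, w ≠ 0 ∧ (b - a) * w = 0

/-- The polynomial `∏_{u ∈ A_k} (x_k - u)^{ψ_k(u)}` attached to the `k`-th member of a family of
finite sets `A` with multiplicities `ψ`. -/
noncomputable def multisetPoly (A : Fin n → Finset R) (ψ : Fin n → R → ℕ) (k : Fin n) :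
    MvPolynomial (Fin n) R :=
  ∏ u ∈ A k, (X k - C u) ^ ψ k u

/-- The quotient `g_k / h_k`, where `g = multisetPoly S ψ`, `h = multisetPoly E ψ` and `E ⊆ S`.
See `eq_quotPoly_iff`: it is the only polynomial whose product with `h_k` is `g_k`. -/
noncomputable def quotPoly [DecidableEq R] (S E : Fin n → Finset R) (ψ : Fin n → R → ℕ)
    (k : Fin n) : MvPolynomial (Fin n) R :=
  multisetPoly (fun i => S i \ E i) ψ k

/-- The ideal `𝓘_t(g_1, …, g_n)` generated by all products `∏_k g_k ^ α_k` with `∑_k α_k = t`. -/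
noncomputable def powIdeal (t : ℕ) (g : Fin n → MvPolynomial (Fin n) R) :
    Ideal (MvPolynomial (Fin n) R) :=
  Ideal.span {p | ∃ α : Fin n →₀ ℕ, ∑ i, α i = t ∧ p = ∏ k, g k ^ α k}

/-- The polynomial `f(x_1 + a_1, …, x_n + a_n)`. -/
noncomputable def shift (a : Fin n → R) (f : MvPolynomial (Fin n) R) : MvPolynomial (Fin n) R :=
  aeval (fun i => X i + C (a i)) f

/-- The weighted order `∑_i ⌊β_i / ψ_i(a_i)⌋` of an exponent `β` at a point `a`. -/
def weightedOrder (ψ : Fin n → R → ℕ) (a : Fin n → R) (β : Fin n →₀ ℕ) : ℕ :=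
  ∑ i, β i / ψ i (a i)

/-- All coefficients of `f(x + a)` of weighted order at most `s - 1` vanish
(no condition if `s = 0`). -/
def VanishesTo (ψ : Fin n → R → ℕ) (s : ℕ) (a : Fin n → R) (f : MvPolynomial (Fin n) R) : Prop :=
  ∀ β : Fin n →₀ ℕ, weightedOrder ψ a β < s → coeff β (shift a f) = 0

/-- The set `Q` (for `t ≥ 1`): polynomials that vanish to weighted order `t` at the points of
`∏ S_i` outside `∏ E_i`, and to weighted order `t - 1` at the points of `∏ E_i`. -/
def puncturedSet (S E : Fin n → Finset R) (ψ : Fin n → R → ℕ) (t : ℕ) :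
    Set (MvPolynomial (Fin n) R) :=
  {f | (∀ a : Fin n → R, (∀ i, a i ∈ S i) → (¬ ∀ i, a i ∈ E i) → VanishesTo ψ t a f) ∧
    (∀ a : Fin n → R, (∀ i, a i ∈ E i) → VanishesTo ψ (t - 1) a f)}

theorem X_sub_C_mul_cancel (k : Fin n) (u : R) {p q : MvPolynomial (Fin n) R}
    (h : p * (X k - C u) = q * (X k - C u)) : p = q := by
  have key : ∀ f : MvPolynomial (Fin n) R, shift (fun i => -u) (shift (fun _ => u) f) = f := by
    intro f
    induction f using MvPolynomial.induction_on with
    | C a => simp [shift]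
    | add p q hp hq => simp only [shift, map_add] at *; rw [hp, hq]
    | mul_X p i hp =>
      simp only [shift, map_mul, map_add, aeval_X] at *
      rw [hp]
      rw [algHom_C, algebraMap_eq, add_assoc, ← C_add, neg_add_cancel, C_0, add_zero]
  have h2 := congrArg (shift (fun _ => u)) h
  simp only [shift, map_mul, map_sub, aeval_X, algHom_C, algebraMap_eq, add_sub_cancel_right]
    at h2
  have h3 : shift (fun _ => u) p = shift (fun _ => u) q := by
    ext m
    have := congrArg (coeff (m + Finsupp.single k 1)) h2
    simpa [shift, coeff_mul_X] using this
  rw [← key p, ← key q, h3]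

/-- `quotPoly S E ψ k` is the quotient of `g_k` by `h_k`. -/
theorem eq_quotPoly_iff [DecidableEq R] (S E : Fin n → Finset R) (hE : ∀ k, E k ⊆ S k)
    (ψ : Fin n → R → ℕ) (k : Fin n) (p : MvPolynomial (Fin n) R) :
    p = quotPoly S E ψ k ↔ p * multisetPoly E ψ k = multisetPoly S ψ k := by
  have h1 : quotPoly S E ψ k * multisetPoly E ψ k = multisetPoly S ψ k := by
    simp only [quotPoly, multisetPoly]
    exact Finset.prod_sdiff (hE k)
  have h2 : IsRightRegular (multisetPoly E ψ k) := by
    apply IsRegular.right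
    unfold multisetPoly
    refine IsRegular.prod fun u _ => IsRegular.pow _ ?_
    have : IsRightRegular (X k - C u : MvPolynomial (Fin n) R) :=
      fun p q h => X_sub_C_mul_cancel k u h
    exact ⟨fun p q h => this (by simpa [mul_comm] using h), this⟩
  constructor
  · rintro rfl; exact h1
  · intro h; exact h2 (h.trans h1.symm)

end PuncturedNull

namespace PuncturedNull

open MvPolynomial

/-! Everything rests on one Newton basis. For each `i`, list the roots of `g_i` with multiplicity,
those of `g_i / h_i` first, and repeat the list periodically. The products of initial segments `∏_{l
< κ_i} (x_i - w_i(l))` span the polynomial ring, and no index used exceeds the total degree of the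
polynomial expanded. The index `κ` is detected by one coefficient of the shift to the point
`(w_i(κ_i))_i`: the exponent in `x_i` counts how often that root occurred before. Basis elements
with index not below `κ` do not contribute, and `κ` itself contributes a product of root
differences, a non zero divisor by (D). So if the detecting coefficients vanish on a lower set of
indices, the expansion has no term there (`newtonBasis_coeff_eq_zero`). With `d_i = deg g_i`, the
detecting exponent has weighted order `∑ ⌊κ_i / d_i⌋`. Membership in `Q` therefore kills all indices
except those of order at least `t`, and those of order `t - 1` whose remainders all pass the `g_i /
h_i` block. The corresponding basis elements are visibly multiples of generators of the ideals in
(2). The case of empty `E_i` is the Nullstellensatz `mem_powIdeal_iff`, which yields (1) and (3);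
the degree control gives the minimum in (4). -/

/-! ### Periodic sequences and visit counts -/

/-- The periodic sequence running through the list `L`. -/
def periodicSeq {R : Type*} [Zero R] (L : List R) (k : ℕ) : R := L.getD (k % L.length) 0

theorem periodicSeq_add_mul {R : Type*} [Zero R] (L : List R) (j r : ℕ) :
    periodicSeq L (j * L.length + r) = periodicSeq L r := by
  simp [periodicSeq, Nat.add_mod]

theorem periodicSeq_of_lt {R : Type*} [Zero R] (L : List R) {k : ℕ} (hk : k < L.length) :
    periodicSeq L k = L[k] := by
  simp [periodicSeq, Nat.mod_eq_of_lt hk, hk]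

theorem periodicSeq_mem {R : Type*} [Zero R] {L : List R} (hL : L ≠ []) (k : ℕ) :
    periodicSeq L k ∈ L := by
  have h : k % L.length < L.length := Nat.mod_lt _ (List.length_pos_iff.2 hL)
  simp [periodicSeq, h]

theorem prod_range_periodicSeq {R M : Type*} [Zero R] [CommMonoid M] (L : List R) (f : R → M) :
    ∏ l ∈ Finset.range L.length, f (periodicSeq L l) = (L.map f).prod := by
  rw [Finset.prod_range, ← Fin.prod_univ_fun_getElem]
  exact Finset.prod_congr rfl fun i _ => by rw [periodicSeq_of_lt L i.2]

theorem prod_range_periodicSeq_append {R M : Type*} [Zero R] [CommMonoid M] (L L' : List R)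
    (f : R → M) :
    ∏ l ∈ Finset.range L.length, f (periodicSeq (L ++ L') l) = (L.map f).prod := by
  rw [← prod_range_periodicSeq]
  refine Finset.prod_congr rfl fun i hi => ?_
  have hi' := Finset.mem_range.1 hi
  rw [periodicSeq_of_lt L hi', periodicSeq_of_lt _ (by simp; omega), List.getElem_append_left hi']

theorem prod_range_periodicSeq_add {R M : Type*} [Zero R] [CommMonoid M] (L : List R) (f : R → M)
    (j r : ℕ) :
    ∏ l ∈ Finset.range (j * L.length + r), f (periodicSeq L l) =
      (∏ l ∈ Finset.range L.length, f (periodicSeq L l)) ^ j *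
        ∏ l ∈ Finset.range r, f (periodicSeq L l) := by
  rw [Finset.prod_range_add]
  simp only [periodicSeq_add_mul]
  congr 1
  induction j with
  | zero => simp
  | succ j ih =>
    rw [Nat.succ_mul, Finset.prod_range_add, ih, pow_succ]
    simp only [periodicSeq_add_mul]

/-- The number of indices below `k` at which `w` takes the value `u`. -/
def visits {R : Type*} [DecidableEq R] (w : ℕ → R) (u : R) (k : ℕ) : ℕ :=
  ∑ l ∈ Finset.range k, if w l = u then 1 else 0

theorem visits_mono {R : Type*} [DecidableEq R] (w : ℕ → R) (u : R) {k k' : ℕ} (h : k ≤ k') :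
    visits w u k ≤ visits w u k' :=
  Finset.sum_le_sum_of_subset (Finset.range_mono h)

theorem visits_lt {R : Type*} [DecidableEq R] (w : ℕ → R) {k k' : ℕ} (h : k < k') :
    visits w (w k) k < visits w (w k) k' := by
  refine lt_of_lt_of_le ?_ (visits_mono w _ (Nat.succ_le_of_lt h))
  rw [visits, visits, Finset.sum_range_succ, if_pos rfl]
  exact Nat.lt_succ_self _

theorem visits_periodicSeq_length {R : Type*} [Zero R] [DecidableEq R] (L : List R) (u : R) :
    visits (periodicSeq L) u L.length = L.count u := by
  have h : visits (periodicSeq L) u L.length = (L.map fun x => if x = u then 1 else 0).sum := by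
    unfold visits
    rw [Finset.sum_range, ← Fin.sum_univ_fun_getElem]
    exact Finset.sum_congr rfl fun i _ => by rw [periodicSeq_of_lt L i.2]
  rw [h]
  clear h
  induction L with
  | nil => simp
  | cons a L ih => simp [List.count_cons, ih, add_comm]

/-- Each completed period visits the current value `count` times. The unfinished period has visited
it fewer than `count` times, since the current position is itself a further visit, so the floor sees
only completed periods. -/
theorem visits_periodicSeq_div {R : Type*} [Zero R] [DecidableEq R] {L : List R} (hL : L ≠ []) (k : ℕ) :
    visits (periodicSeq L) (periodicSeq L k) k / L.count (periodicSeq L k) = k / L.length := by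
  have hpos := List.length_pos_iff.2 hL
  have hr : k % L.length < L.length := Nat.mod_lt _ hpos
  have hk : k / L.length * L.length + k % L.length = k := by
    rw [mul_comm]; exact Nat.div_add_mod k L.length
  set j := k / L.length
  set r := k % L.length
  have hw : periodicSeq L k = periodicSeq L r := by rw [← hk, periodicSeq_add_mul]
  have hv : visits (periodicSeq L) (periodicSeq L r) k =
      L.count (periodicSeq L r) * j + visits (periodicSeq L) (periodicSeq L r) r := by
    -- The multiplicative periodicity, read in `Multiplicative`, counts visits.
    have := prod_range_periodicSeq_add L
      (fun x => Multiplicative.ofAdd (if x = periodicSeq L r then 1 else 0)) j r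
    simp only [← ofAdd_sum, ← ofAdd_nsmul, ← ofAdd_add] at this
    have h2 := Multiplicative.ofAdd.injective this
    rw [hk] at h2
    rw [← visits_periodicSeq_length, mul_comm]
    exact h2
  have hlt : visits (periodicSeq L) (periodicSeq L r) r < L.count (periodicSeq L r) := by
    rw [← visits_periodicSeq_length]
    exact visits_lt _ hr
  rw [hw, hv, Nat.mul_add_div (by omega), Nat.div_eq_of_lt hlt, add_zero]

/-! ### The Newton basis and its triangularity -/

section Newton

variable {R : Type*} [CommRing R] [DecidableEq R]

/-- The monic polynomial whose roots are the first `k` terms of `w`. -/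
noncomputable def newtonPoly {R : Type*} [CommRing R] (w : ℕ → R) (k : ℕ) : Polynomial R :=
  ∏ l ∈ Finset.range k, (Polynomial.X - Polynomial.C (w l))

theorem newtonPoly_comp (w : ℕ → R) (k : ℕ) (a : R) :
    (newtonPoly w k).comp (Polynomial.X + Polynomial.C a) =
      Polynomial.X ^ visits w a k *
        ∏ l ∈ Finset.range k with w l ≠ a, (Polynomial.X + Polynomial.C (a - w l)) := by
  rw [newtonPoly, Polynomial.prod_comp,
    ← Finset.prod_filter_mul_prod_filter_not _ (fun l => w l = a)]
  congr 1
  · rw [visits, ← Finset.card_filter]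
    refine Finset.prod_eq_pow_card fun l hl => ?_
    simp [(Finset.mem_filter.1 hl).2]
  · refine Finset.prod_congr rfl fun l _ => ?_
    simp; ring

/-- The longer product contains the root `w k` at least once more, so its shift is divisible by a
higher power of `X`. -/
theorem coeff_newtonPoly_comp_of_lt (w : ℕ → R) {k k' : ℕ} (h : k < k') :
    ((newtonPoly w k').comp (Polynomial.X + Polynomial.C (w k))).coeff (visits w (w k) k) = 0 := by
  rw [newtonPoly_comp, Polynomial.coeff_X_pow_mul', if_neg (not_le.2 (visits_lt w h))]

theorem ConditionD.sub_mem_nonZeroDivisors {R : Type*} [CommRing R] {X : Set R} (hX : ConditionD X) {a b : R} (ha : a ∈ X)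
    (hb : b ∈ X) (hab : a ≠ b) : b - a ∈ nonZeroDivisors R := by
  rw [mem_nonZeroDivisors_iff_right]
  intro x hx
  by_contra hne
  exact hX a ha b hb hab ⟨x, hne, by rw [mul_comm, hx]⟩

/-- This is the lowest coefficient after the shift: the product of the differences `w k - w l` over
earlier roots different from `w k`. -/
theorem coeff_newtonPoly_comp_self {w : ℕ → R} {X : Set R} (hX : ConditionD X)
    (hw : ∀ l, w l ∈ X) (k : ℕ) :
    ((newtonPoly w k).comp (Polynomial.X + Polynomial.C (w k))).coeff (visits w (w k) k) ∈
      nonZeroDivisors R := by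
  rw [newtonPoly_comp, Polynomial.coeff_X_pow_mul', if_pos le_rfl, Nat.sub_self,
    Polynomial.coeff_zero_eq_eval_zero, Polynomial.eval_prod]
  refine Submonoid.prod_mem _ fun l hl => ?_
  simpa using hX.sub_mem_nonZeroDivisors (hw l) (hw k) (Finset.mem_filter.1 hl).2

variable {n : ℕ}

theorem coeff_prod_aeval_X {R : Type*} [CommRing R] (p : Fin n → Polynomial R) (β : Fin n →₀ ℕ) :
    coeff β (∏ i, Polynomial.aeval (X i : MvPolynomial (Fin n) R) (p i)) =
      ∏ i, (p i).coeff (β i) := by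
  have h1 : ∀ i, Polynomial.aeval (X i : MvPolynomial (Fin n) R) (p i) =
      ∑ m ∈ (p i).support, C ((p i).coeff m) * X i ^ m := by
    intro i
    rw [Polynomial.aeval_def, Polynomial.eval₂_eq_sum, Polynomial.sum]
    rfl
  have h2 : ∀ κ : Fin n → ℕ,
      ∏ i, (C ((p i).coeff (κ i)) * X i ^ κ i : MvPolynomial (Fin n) R) =
        monomial (Finsupp.equivFunOnFinite.symm κ) (∏ i, (p i).coeff (κ i)) := by
    intro κ
    rw [Finset.prod_mul_distrib, ← map_prod, monomial_eq, Finsupp.prod_fintype _ _ (by simp)]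
    simp
  simp only [h1]
  rw [Finset.prod_univ_sum]
  simp only [h2, coeff_sum, coeff_monomial]
  rw [Finset.sum_eq_single (⇑β)]
  · simp
  · intro κ _ hκ
    rw [if_neg]
    rintro rfl
    exact hκ (by simp)
  · intro hβ
    simp only [Fintype.mem_piFinset, not_forall, Polynomial.mem_support_iff, not_not] at hβ
    obtain ⟨i, hi⟩ := hβ
    rw [if_pos (by simp), Finset.prod_eq_zero (Finset.mem_univ i) hi]

/-- The product of the Newton polynomials `newtonPoly (w i) (κ i)` in the variables `X i`. -/
noncomputable def newtonBasis {R : Type*} [CommRing R] (w : Fin n → ℕ → R) (κ : Fin n →₀ ℕ) :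
    MvPolynomial (Fin n) R :=
  ∏ i, Polynomial.aeval (X i) (newtonPoly (w i) (κ i))

theorem shift_newtonBasis {R : Type*} [CommRing R] (w : Fin n → ℕ → R) (κ : Fin n →₀ ℕ)
    (a : Fin n → R) :
    shift a (newtonBasis w κ) = ∏ i, Polynomial.aeval (X i : MvPolynomial (Fin n) R)
      ((newtonPoly (w i) (κ i)).comp (Polynomial.X + Polynomial.C (a i))) := by
  rw [newtonBasis, shift, map_prod]
  refine Finset.prod_congr rfl fun i _ => ?_
  rw [← Polynomial.aeval_algHom_apply, Polynomial.aeval_comp]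
  simp [algebraMap_eq]

/-- The exponent at which the basis element of index `κ` is detected at the point `w_κ`. -/
noncomputable def visitExponent (w : Fin n → ℕ → R) (κ : Fin n →₀ ℕ) : Fin n →₀ ℕ :=
  Finsupp.equivFunOnFinite.symm fun i => visits (w i) (w i (κ i)) (κ i)

theorem coeff_shift_newtonBasis_eq_zero (w : Fin n → ℕ → R) {κ κ' : Fin n →₀ ℕ} (h : ¬ κ' ≤ κ) :
    coeff (visitExponent w κ) (shift (fun i => w i (κ i)) (newtonBasis w κ')) = 0 := by
  rw [shift_newtonBasis, coeff_prod_aeval_X]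
  simp only [Finsupp.le_def, not_forall, not_le] at h
  obtain ⟨i, hi⟩ := h
  exact Finset.prod_eq_zero (Finset.mem_univ i) (coeff_newtonPoly_comp_of_lt _ hi)

theorem coeff_shift_newtonBasis_self {S : Fin n → Set R} (hS : ∀ i, ConditionD (S i))
    {w : Fin n → ℕ → R} (hw : ∀ i l, w i l ∈ S i) (κ : Fin n →₀ ℕ) :
    coeff (visitExponent w κ) (shift (fun i => w i (κ i)) (newtonBasis w κ)) ∈
      nonZeroDivisors R := by
  rw [shift_newtonBasis, coeff_prod_aeval_X]
  exact Submonoid.prod_mem _ fun i _ => coeff_newtonPoly_comp_self (hS i) (hw i) _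

theorem X_mul_newtonBasis {R : Type*} [CommRing R] (w : Fin n → ℕ → R) (κ : Fin n →₀ ℕ)
    (i : Fin n) :
    X i * newtonBasis w κ =
      newtonBasis w (κ + Finsupp.single i 1) + w i (κ i) • newtonBasis w κ := by
  have h : newtonBasis w (κ + Finsupp.single i 1) =
      (X i - C (w i (κ i))) * newtonBasis w κ := by
    unfold newtonBasis
    rw [← Finset.mul_prod_erase _ _ (Finset.mem_univ i),
      ← Finset.mul_prod_erase Finset.univ (fun j => Polynomial.aeval (X j)
        (newtonPoly (w j) (κ j))) (Finset.mem_univ i), ← mul_assoc]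
    congr 1
    · simp [newtonPoly, Finset.prod_range_succ, mul_comm, algebraMap_eq]
    · refine Finset.prod_congr rfl fun j hj => ?_
      rw [Finsupp.add_apply, Finsupp.single_eq_of_ne (Finset.ne_of_mem_erase hj), add_zero]
  rw [h, smul_eq_C_mul]
  ring

/-- Multiplication by `X i` raises the index degree by at most one, by `X_mul_newtonBasis`, so
monomials are handled by induction on degree. The degree bound is kept for the minimum in (4). -/
theorem mem_span_newtonBasis {R : Type*} [CommRing R] (w : Fin n → ℕ → R)
    (f : MvPolynomial (Fin n) R) :
    f ∈ Submodule.span R (newtonBasis w '' {κ | κ.degree ≤ f.totalDegree}) := by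
  have hmon : ∀ d, ∀ β : Fin n →₀ ℕ, β.degree = d → (monomial β 1 : MvPolynomial (Fin n) R) ∈
      Submodule.span R (newtonBasis w '' {κ | κ.degree ≤ d}) := by
    intro d
    induction d with
    | zero =>
      intro β hβ
      rw [Finsupp.degree_eq_zero_iff] at hβ
      refine Submodule.subset_span ⟨0, by simp, ?_⟩
      simp [newtonBasis, newtonPoly, hβ]
    | succ d ih =>
      intro β hβ
      have hne : β ≠ 0 := by rintro rfl; simp at hβ
      obtain ⟨i, hi⟩ := Finsupp.ne_iff.1 hne
      have hβi : β - Finsupp.single i 1 + Finsupp.single i 1 = β :=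
        tsub_add_cancel_of_le (Finsupp.single_le_iff.2 (Nat.one_le_iff_ne_zero.2 hi))
      have hd : (β - Finsupp.single i 1).degree = d := by
        have := congrArg Finsupp.degree hβi
        rw [map_add, Finsupp.degree_single, hβ] at this
        omega
      have hm : (monomial β 1 : MvPolynomial (Fin n) R) =
          LinearMap.mulLeft R (X i) (monomial (β - Finsupp.single i 1) 1) := by
        rw [LinearMap.mulLeft_apply, X, monomial_mul, add_comm, hβi, one_mul]
      rw [hm]
      refine (Submodule.map_le_iff_le_comap.2 (Submodule.span_le.2 ?_))
        (Submodule.mem_map_of_mem (ih _ hd))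
      rintro _ ⟨κ, hκ, rfl⟩
      simp only [Set.mem_ofPred_eq] at hκ
      simp only [SetLike.mem_coe, Submodule.mem_comap, LinearMap.mulLeft_apply]
      rw [X_mul_newtonBasis]
      refine Submodule.add_mem _ (Submodule.subset_span ⟨_, ?_, rfl⟩)
        (Submodule.smul_mem _ _ (Submodule.subset_span ⟨_, ?_, rfl⟩))
      · simp [hκ]
      · simp only [Set.mem_ofPred_eq]; omega
  rw [f.as_sum]
  refine Submodule.sum_mem _ fun β hβ => ?_
  have h1 : monomial β (coeff β f) = coeff β f • (monomial β 1 : MvPolynomial (Fin n) R) := by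
    rw [smul_monomial, smul_eq_mul, mul_one]
  rw [h1, ← f.as_sum]
  refine Submodule.smul_mem _ _ (Submodule.span_mono (Set.image_mono fun κ hκ => ?_)
    (hmon _ β rfl))
  exact le_trans hκ (le_totalDegree hβ)

/-- A polynomial whose detecting coefficients vanish on a lower set of indices has no component on
that lower set. -/
theorem newtonBasis_coeff_eq_zero {S : Fin n → Set R} (hS : ∀ i, ConditionD (S i))
    {w : Fin n → ℕ → R} (hw : ∀ i l, w i l ∈ S i) {K : Set (Fin n →₀ ℕ)} (hK : IsLowerSet K)
    (c : (Fin n →₀ ℕ) →₀ R)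
    (hc : ∀ κ ∈ K, coeff (visitExponent w κ)
      (shift (fun i => w i (κ i)) (Finsupp.linearCombination R (newtonBasis w) c)) = 0) :
    ∀ κ ∈ K, c κ = 0 := by
  intro κ
  induction κ using WellFoundedLT.induction with
  | ind κ ih =>
    intro hκ
    have h := hc κ hκ
    simp only [shift, Finsupp.linearCombination_apply, Finsupp.sum, map_sum, map_smul, coeff_sum,
      coeff_smul, smul_eq_mul] at h
    -- Terms strictly below `κ` vanish by induction, as the set is lower; terms not below `κ` have
    -- zero detecting coefficient.
    rw [Finset.sum_eq_single κ] at h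
    · exact (mem_nonZeroDivisors_iff_right.1 (coeff_shift_newtonBasis_self hS hw κ)) _ h
    · intro κ' _ hne
      by_cases hle : κ' ≤ κ
      · rw [ih κ' (lt_of_le_of_ne hle hne) (hK hle hκ), zero_mul]
      · have := coeff_shift_newtonBasis_eq_zero w hle
        rw [shift] at this
        rw [this, mul_zero]
    · intro hn
      rw [Finsupp.notMem_support_iff.1 hn, zero_mul]

end Newton

/-! ### Calculus of weighted vanishing -/

section Vanishing

variable {R : Type*} [CommRing R] {n : ℕ} {ψ : Fin n → R → ℕ} {a : Fin n → R}

theorem shift_mul (p f : MvPolynomial (Fin n) R) : shift a (p * f) = shift a p * shift a f :=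
  map_mul _ _ _

theorem VanishesTo.add {s : ℕ} {p f : MvPolynomial (Fin n) R} (hp : VanishesTo ψ s a p)
    (hf : VanishesTo ψ s a f) : VanishesTo ψ s a (p + f) := by
  intro β hβ
  have h : shift a (p + f) = shift a p + shift a f := map_add _ _ _
  rw [h, coeff_add, hp β hβ, hf β hβ, add_zero]

theorem VanishesTo.zero_left (f : MvPolynomial (Fin n) R) : VanishesTo ψ 0 a f :=
  fun _ h => absurd h (Nat.not_lt_zero _)

theorem VanishesTo.mono {s s' : ℕ} {f : MvPolynomial (Fin n) R} (hf : VanishesTo ψ s a f)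
    (h : s' ≤ s) : VanishesTo ψ s' a f :=
  fun β hβ => hf β (hβ.trans_le h)

theorem weightedOrder_add_le {R : Type*} {n : ℕ} {ψ : Fin n → R → ℕ} {a : Fin n → R} (β β' : Fin n →₀ ℕ) :
    weightedOrder ψ a β + weightedOrder ψ a β' ≤ weightedOrder ψ a (β + β') := by
  unfold weightedOrder
  rw [← Finset.sum_add_distrib]
  exact Finset.sum_le_sum fun i _ => Nat.div_add_div_le_add_div

/-- Floors are superadditive, so when an exponent of order below `s + s'` splits in two, one part
falls below its own threshold. -/
theorem VanishesTo.mul {s s' : ℕ} {p f : MvPolynomial (Fin n) R} (hp : VanishesTo ψ s a p)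
    (hf : VanishesTo ψ s' a f) : VanishesTo ψ (s + s') a (p * f) := by
  intro β hβ
  rw [shift_mul, coeff_mul]
  refine Finset.sum_eq_zero fun x hx => ?_
  rw [Finset.HasAntidiagonal.mem_antidiagonal] at hx
  have hle := weightedOrder_add_le (ψ := ψ) (a := a) x.1 x.2
  rw [hx] at hle
  rcases lt_or_ge (weightedOrder ψ a x.1) s with h | h
  · rw [hp _ h, zero_mul]
  · rw [hf _ (by omega), mul_zero]

theorem VanishesTo.mul_right {s : ℕ} {p : MvPolynomial (Fin n) R} (hp : VanishesTo ψ s a p)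
    (f : MvPolynomial (Fin n) R) : VanishesTo ψ s a (p * f) :=
  hp.mul (VanishesTo.zero_left f)

theorem VanishesTo.mul_left {s : ℕ} {p : MvPolynomial (Fin n) R} (hp : VanishesTo ψ s a p)
    (f : MvPolynomial (Fin n) R) : VanishesTo ψ s a (f * p) := by
  rw [mul_comm]; exact hp.mul_right f

theorem VanishesTo.pow {s : ℕ} {p : MvPolynomial (Fin n) R} (hp : VanishesTo ψ s a p) (k : ℕ) :
    VanishesTo ψ (k * s) a (p ^ k) := by
  induction k with
  | zero => simpa using VanishesTo.zero_left _
  | succ k ih => rw [pow_succ, Nat.succ_mul]; exact ih.mul hp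

theorem VanishesTo.prod {ι : Type*} (I : Finset ι) {s : ι → ℕ}
    {p : ι → MvPolynomial (Fin n) R} (hp : ∀ i ∈ I, VanishesTo ψ (s i) a (p i)) :
    VanishesTo ψ (∑ i ∈ I, s i) a (∏ i ∈ I, p i) := by
  classical
  induction I using Finset.induction_on with
  | empty => exact VanishesTo.zero_left _
  | insert j I hj ih =>
    rw [Finset.sum_insert hj, Finset.prod_insert hj]
    exact (hp j (Finset.mem_insert_self _ _)).mul
      (ih fun i hi => hp i (Finset.mem_insert_of_mem hi))

/-- The factor at the root `a k` alone suffices: it shifts to the monomial `x_k ^ ψ`, whose weighted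
order is one. -/
theorem vanishesTo_one_multisetPoly [DecidableEq R] {A : Fin n → Finset R} {k : Fin n} (hk : a k ∈ A k)
    (hψ : 0 < ψ k (a k)) : VanishesTo ψ 1 a (multisetPoly A ψ k) := by
  rw [multisetPoly, ← Finset.mul_prod_erase _ _ hk]
  refine VanishesTo.mul_right ?_ _
  intro β hβ
  have h : shift a ((X k - C (a k)) ^ ψ k (a k)) = monomial (Finsupp.single k (ψ k (a k))) 1 := by
    simp [shift, algebraMap_eq, X_pow_eq_monomial]
  rw [h, coeff_monomial, if_neg]
  rintro rfl
  refine (Nat.one_le_iff_ne_zero.1 ?_) (Nat.lt_one_iff.1 hβ)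
  refine le_trans ?_ (Finset.single_le_sum (fun i _ => Nat.zero_le _) (Finset.mem_univ k))
  simp [Nat.div_self hψ]

theorem vanishesTo_of_mem_powIdeal {g : Fin n → MvPolynomial (Fin n) R}
    (hg : ∀ i, VanishesTo ψ 1 a (g i)) {t : ℕ} {f : MvPolynomial (Fin n) R}
    (hf : f ∈ powIdeal t g) : VanishesTo ψ t a f := by
  refine Submodule.span_induction ?_ ?_ (fun _ _ _ _ => VanishesTo.add)
    (fun r _ _ hx => hx.mul_left r) hf
  · rintro _ ⟨α, rfl, rfl⟩
    simpa using VanishesTo.prod Finset.univ fun i _ => (hg i).pow (α i)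
  · intro β _
    simp [shift]

end Vanishing

/-! ### Power ideals -/

theorem prod_pow_mem_powIdeal {R : Type*} [CommRing R] {n : ℕ}
    (g : Fin n → MvPolynomial (Fin n) R) (α : Fin n → ℕ) :
    ∏ i, g i ^ α i ∈ powIdeal (∑ i, α i) g :=
  Ideal.subset_span ⟨Finsupp.equivFunOnFinite.symm α, by simp, by simp⟩

theorem powIdeal_anti {R : Type*} [CommRing R] {n : ℕ} (g : Fin n → MvPolynomial (Fin n) R)
    {s t : ℕ} (h : s ≤ t) : powIdeal t g ≤ powIdeal s g := by
  rw [powIdeal, Ideal.span_le]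
  rintro _ ⟨α, hα, rfl⟩
  obtain ⟨m, hm⟩ := Nat.exists_eq_add_of_le h
  clear h
  induction m generalizing t α with
  | zero =>
    obtain rfl : t = s := by omega
    exact Ideal.subset_span ⟨α, hα, rfl⟩
  | succ m ih =>
    have : ∃ i, α i ≠ 0 := by
      by_contra! h0
      simp [h0] at hα
      omega
    obtain ⟨i, hi⟩ := this
    have hαi : α - Finsupp.single i 1 + Finsupp.single i 1 = α :=
      tsub_add_cancel_of_le (Finsupp.single_le_iff.2 (Nat.one_le_iff_ne_zero.2 hi))
    have hsum : ∑ j, (α - Finsupp.single i 1 : Fin n →₀ ℕ) j + 1 = ∑ j, α j := by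
      conv_rhs => rw [← hαi]
      simp [Finset.sum_add_distrib, Finsupp.single_apply]
    have hprod : ∏ j, g j ^ α j = (∏ j, g j ^ (α - Finsupp.single i 1 : Fin n →₀ ℕ) j) * g i := by
      conv_lhs => rw [← hαi]
      simp only [Finsupp.add_apply, pow_add, Finset.prod_mul_distrib]
      congr 1
      rw [Finset.prod_eq_single i] <;> simp +contextual [eq_comm]
    rw [hprod]
    exact Ideal.mul_mem_right _ _ (ih (t := s + m) _ (by omega) rfl)

/-- Serves the degenerate case of an empty `S_i`, where `g_i = 1` and no root sequence exists. -/
theorem powIdeal_eq_top {R : Type*} [CommRing R] {n : ℕ} {g : Fin n → MvPolynomial (Fin n) R}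
    {i : Fin n} (hi : g i = 1) (t : ℕ) : powIdeal t g = ⊤ := by
  rw [Ideal.eq_top_iff_one]
  refine Ideal.subset_span ⟨Finsupp.single i t, by simp [Finsupp.single_apply], ?_⟩
  refine (Finset.prod_eq_one fun j _ => ?_).symm
  by_cases h : j = i
  · rw [h, hi, one_pow]
  · rw [Finsupp.single_eq_of_ne h, pow_zero]

/-! ### Lists of roots with multiplicity -/

section RootList

variable {R : Type*}

/-- A list in which every `u ∈ A` occurs `m u` times. -/
noncomputable def rootList (A : Finset R) (m : R → ℕ) : List R :=
  (∑ u ∈ A, Multiset.replicate (m u) u).toList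

theorem prod_map_rootList {M : Type*} [CommMonoid M] (A : Finset R) (m : R → ℕ) (f : R → M) :
    ((rootList A m).map f).prod = ∏ u ∈ A, f u ^ m u := by
  rw [rootList, ← Multiset.prod_coe, ← Multiset.map_coe, Multiset.coe_toList,
    ← Multiset.coe_mapAddMonoidHom, map_sum, Multiset.prod_sum]
  simp

theorem length_rootList (A : Finset R) (m : R → ℕ) : (rootList A m).length = ∑ u ∈ A, m u := by
  simp [rootList]

theorem count_rootList [DecidableEq R] (A : Finset R) (m : R → ℕ) (v : R) :
    (rootList A m).count v = if v ∈ A then m v else 0 := by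
  rw [rootList, ← Multiset.coe_count, Multiset.coe_toList, Multiset.count_sum']
  simp [Multiset.count_replicate]

theorem mem_of_mem_rootList {A : Finset R} {m : R → ℕ} {v : R} (h : v ∈ rootList A m) :
    v ∈ A := by
  rw [rootList, Multiset.mem_toList, Multiset.mem_sum] at h
  obtain ⟨u, hu, h⟩ := h
  rwa [Multiset.eq_of_mem_replicate h]

end RootList

/-! ### Newton expansion of the punctured set -/

section Punctured

variable {R : Type*} [CommRing R] [DecidableEq R] {n : ℕ} (S E : Fin n → Finset R)
  (ψ : Fin n → R → ℕ)

/-- The roots of `g_i`, with multiplicity, those of `g_i / h_i` first. -/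
noncomputable def splitList (i : Fin n) : List R :=
  rootList (S i \ E i) (ψ i) ++ rootList (E i) (ψ i)

/-- The periodic sequence of roots of `g_i`. -/
noncomputable def rootSeq (i : Fin n) : ℕ → R := periodicSeq (splitList S E ψ i)

variable {S E ψ}

theorem length_splitList {R : Type*} [DecidableEq R] {S E : Fin n → Finset R}
    {ψ : Fin n → R → ℕ} (hE : ∀ k, E k ⊆ S k) (i : Fin n) :
    (splitList S E ψ i).length = ∑ u ∈ S i, ψ i u := by
  rw [splitList, List.length_append, length_rootList, length_rootList, Finset.sum_sdiff (hE i)]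

theorem count_splitList {R : Type*} [DecidableEq R] {S E : Fin n → Finset R}
    {ψ : Fin n → R → ℕ} {i : Fin n} {u : R} (hu : u ∈ S i) :
    (splitList S E ψ i).count u = ψ i u := by
  rw [splitList, List.count_append, count_rootList, count_rootList]
  by_cases h : u ∈ E i <;> simp [h, hu]

theorem splitList_ne_nil {R : Type*} [DecidableEq R] {S E : Fin n → Finset R}
    {ψ : Fin n → R → ℕ} (hE : ∀ k, E k ⊆ S k) (hψ : ∀ k, ∀ u ∈ S k, 0 < ψ k u) {i : Fin n}
    (hS : (S i).Nonempty) : splitList S E ψ i ≠ [] := by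
  rw [← List.length_pos_iff, length_splitList hE]
  exact Finset.sum_pos (hψ i) hS

theorem rootSeq_mem (hE : ∀ k, E k ⊆ S k) (hψ : ∀ k, ∀ u ∈ S k, 0 < ψ k u) {i : Fin n}
    (hS : (S i).Nonempty) (k : ℕ) : rootSeq S E ψ i k ∈ S i := by
  have h := periodicSeq_mem (splitList_ne_nil hE hψ hS) k
  rw [splitList, List.mem_append] at h
  rcases h with h | h
  · exact (Finset.mem_sdiff.1 (mem_of_mem_rootList h)).1
  · exact hE i (mem_of_mem_rootList h)

/-- This is why the roots outside `E i` come first in each period. -/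
theorem rootSeq_notMem (hE : ∀ k, E k ⊆ S k) {i : Fin n} {k : ℕ}
    (hk : k % (∑ u ∈ S i, ψ i u) < ∑ u ∈ S i \ E i, ψ i u) : rootSeq S E ψ i k ∉ E i := by
  rw [← length_splitList hE, ← length_rootList] at hk
  have hlt : k % (splitList S E ψ i).length < (splitList S E ψ i).length :=
    hk.trans_le (by simp [splitList])
  have h : rootSeq S E ψ i k = (rootList (S i \ E i) (ψ i))[k % (splitList S E ψ i).length] := by
    rw [rootSeq, periodicSeq, List.getD_eq_getElem _ _ hlt]
    exact List.getElem_append_left hk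
  rw [h]
  exact (Finset.mem_sdiff.1 (mem_of_mem_rootList (List.getElem_mem _))).2

theorem aeval_newtonPoly_rootSeq (hE : ∀ k, E k ⊆ S k) (i : Fin n) (j r : ℕ) :
    Polynomial.aeval (X i : MvPolynomial (Fin n) R)
        (newtonPoly (rootSeq S E ψ i) (j * (∑ u ∈ S i, ψ i u) + r)) =
      multisetPoly S ψ i ^ j * Polynomial.aeval (X i) (newtonPoly (rootSeq S E ψ i) r) := by
  rw [← length_splitList hE]
  simp only [newtonPoly, rootSeq]
  rw [prod_range_periodicSeq_add _ (fun x => Polynomial.X - Polynomial.C x), map_mul, map_pow,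
    prod_range_periodicSeq _ (fun x => Polynomial.X - Polynomial.C x)]
  congr 2
  rw [splitList, List.map_append, List.prod_append, prod_map_rootList, prod_map_rootList,
    Finset.prod_sdiff (hE i), multisetPoly]
  simp [algebraMap_eq]

theorem aeval_newtonPoly_rootSeq_sdiff (i : Fin n) :
    Polynomial.aeval (X i : MvPolynomial (Fin n) R)
        (newtonPoly (rootSeq S E ψ i) (∑ u ∈ S i \ E i, ψ i u)) = quotPoly S E ψ i := by
  rw [← length_rootList]
  simp only [newtonPoly, rootSeq, splitList]
  rw [prod_range_periodicSeq_append _ _ (fun x => Polynomial.X - Polynomial.C x),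
    prod_map_rootList, quotPoly, multisetPoly]
  simp [algebraMap_eq]

theorem newtonPoly_dvd {R : Type*} [CommRing R] (w : ℕ → R) {r s : ℕ} (h : r ≤ s) : newtonPoly w r ∣ newtonPoly w s :=
  Finset.prod_dvd_prod_of_subset _ _ _ (Finset.range_mono h)

theorem pow_dvd_aeval_newtonPoly (hE : ∀ k, E k ⊆ S k) (i : Fin n) (k : ℕ) :
    multisetPoly S ψ i ^ (k / ∑ u ∈ S i, ψ i u) ∣
      Polynomial.aeval (X i : MvPolynomial (Fin n) R) (newtonPoly (rootSeq S E ψ i) k) := by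
  have h := aeval_newtonPoly_rootSeq (ψ := ψ) hE i (k / ∑ u ∈ S i, ψ i u) (k % ∑ u ∈ S i, ψ i u)
  rw [Nat.div_add_mod'] at h
  rw [h]
  exact dvd_mul_right _ _

theorem pow_mul_quotPoly_dvd_aeval_newtonPoly (hE : ∀ k, E k ⊆ S k) {i : Fin n} {k : ℕ}
    (hk : ∑ u ∈ S i \ E i, ψ i u ≤ k % ∑ u ∈ S i, ψ i u) :
    multisetPoly S ψ i ^ (k / ∑ u ∈ S i, ψ i u) * quotPoly S E ψ i ∣
      Polynomial.aeval (X i : MvPolynomial (Fin n) R) (newtonPoly (rootSeq S E ψ i) k) := by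
  have h := aeval_newtonPoly_rootSeq (ψ := ψ) hE i (k / ∑ u ∈ S i, ψ i u) (k % ∑ u ∈ S i, ψ i u)
  rw [Nat.div_add_mod'] at h
  rw [h, ← aeval_newtonPoly_rootSeq_sdiff]
  exact mul_dvd_mul_left _ (map_dvd _ (newtonPoly_dvd _ hk))

theorem weightedOrder_visitExponent (hE : ∀ k, E k ⊆ S k) (hψ : ∀ k, ∀ u ∈ S k, 0 < ψ k u)
    (hS : ∀ i, (S i).Nonempty) (κ : Fin n →₀ ℕ) :
    weightedOrder ψ (fun i => rootSeq S E ψ i (κ i)) (visitExponent (rootSeq S E ψ) κ) =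
      ∑ i, κ i / ∑ u ∈ S i, ψ i u := by
  refine Finset.sum_congr rfl fun i _ => ?_
  rw [← length_splitList hE, ← visits_periodicSeq_div (splitList_ne_nil hE hψ (hS i)),
    ← rootSeq, count_splitList (rootSeq_mem hE hψ (hS i) _)]
  rfl

/-- The index set of the Newton basis elements that span the punctured set. -/
def IsPuncturedIndex (S E : Fin n → Finset R) (ψ : Fin n → R → ℕ) (t : ℕ) (κ : Fin n →₀ ℕ) :
    Prop :=
  t ≤ ∑ i, κ i / ∑ u ∈ S i, ψ i u ∨
    (∑ i, κ i / ∑ u ∈ S i, ψ i u = t - 1 ∧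
      ∀ i, ∑ u ∈ S i \ E i, ψ i u ≤ κ i % ∑ u ∈ S i, ψ i u)

/-- If the order stays at `t - 1`, no single quotient can have grown, so the remainders can only
increase. -/
theorem IsPuncturedIndex.mono {R : Type*} [DecidableEq R] {S E : Fin n → Finset R}
    {ψ : Fin n → R → ℕ} {t : ℕ} {κ κ' : Fin n →₀ ℕ} (hle : κ ≤ κ')
    (h : IsPuncturedIndex S E ψ t κ) : IsPuncturedIndex S E ψ t κ' := by
  have hdiv : ∀ i ∈ Finset.univ, κ i / ∑ u ∈ S i, ψ i u ≤ κ' i / ∑ u ∈ S i, ψ i u :=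
    fun i _ => Nat.div_le_div_right (hle i)
  have hsum := Finset.sum_le_sum hdiv
  rcases h with h | ⟨h, h'⟩
  · exact Or.inl (h.trans hsum)
  · by_cases ht : t ≤ ∑ i, κ' i / ∑ u ∈ S i, ψ i u
    · exact Or.inl ht
    · refine Or.inr ⟨by omega, fun i => (h' i).trans ?_⟩
      have heq := (Finset.sum_eq_sum_iff_of_le hdiv).1 (by omega) i (Finset.mem_univ i)
      have h1 := Nat.div_add_mod (κ i) (∑ u ∈ S i, ψ i u)
      have h2 := Nat.div_add_mod (κ' i) (∑ u ∈ S i, ψ i u)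
      have h3 := hle i
      rw [heq] at h1
      omega

theorem exists_newton_expansion (hE : ∀ k, E k ⊆ S k) (hψ : ∀ k, ∀ u ∈ S k, 0 < ψ k u)
    (hD : ∀ k, ConditionD (S k : Set R)) (hS : ∀ i, (S i).Nonempty) {t : ℕ}
    {f : MvPolynomial (Fin n) R} (hf : f ∈ puncturedSet S E ψ t) :
    ∃ c : (Fin n →₀ ℕ) →₀ R, f = ∑ κ ∈ c.support, c κ • newtonBasis (rootSeq S E ψ) κ ∧
      ∀ κ ∈ c.support, κ.degree ≤ f.totalDegree ∧ IsPuncturedIndex S E ψ t κ := by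
  obtain ⟨c, hc, hcf⟩ := (Finsupp.mem_span_image_iff_linearCombination R).1
    (mem_span_newtonBasis (rootSeq S E ψ) f)
  refine ⟨c, hcf.symm, fun κ hκ => ⟨(Finsupp.mem_supported R c).1 hc hκ, ?_⟩⟩
  by_contra hK
  refine (Finsupp.mem_support_iff.1 hκ) (newtonBasis_coeff_eq_zero hD
    (fun i => rootSeq_mem hE hψ (hS i)) (K := {κ | ¬ IsPuncturedIndex S E ψ t κ})
    (fun _ _ hle h h' => h (h'.mono hle)) c ?_ κ hK)
  intro κ hκ
  rw [hcf]
  simp only [Set.mem_ofPred_eq, IsPuncturedIndex, not_or, not_and, not_forall, not_le] at hκ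
  have hw := weightedOrder_visitExponent hE hψ hS κ
  by_cases hmem : ∀ i, rootSeq S E ψ i (κ i) ∈ E i
  · refine hf.2 _ hmem _ ?_
    rw [hw]
    -- Otherwise the order is exactly `t - 1`, so some remainder lies in the first block and that
    -- coordinate is outside `E i`.
    by_contra hlt
    obtain ⟨i, hi⟩ := hκ.2 (by omega)
    exact rootSeq_notMem hE hi (hmem i)
  · exact hf.1 _ (fun i => rootSeq_mem hE hψ (hS i) _) hmem _ (by rw [hw]; exact hκ.1)

theorem newtonBasis_rootSeq_mem_powIdeal (hE : ∀ k, E k ⊆ S k) {t : ℕ} {κ : Fin n →₀ ℕ}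
    (h : t ≤ ∑ i, κ i / ∑ u ∈ S i, ψ i u) :
    newtonBasis (rootSeq S E ψ) κ ∈ powIdeal t (multisetPoly S ψ) :=
  powIdeal_anti _ h (Ideal.mem_of_dvd _
    (Finset.prod_dvd_prod_of_dvd _ _ fun i _ => pow_dvd_aeval_newtonPoly hE i (κ i))
    (prod_pow_mem_powIdeal _ _))

theorem mem_sup_of_mem_puncturedSet (hE : ∀ k, E k ⊆ S k) (hψ : ∀ k, ∀ u ∈ S k, 0 < ψ k u)
    (hD : ∀ k, ConditionD (S k : Set R)) (hS : ∀ i, (S i).Nonempty) {t : ℕ}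
    {f : MvPolynomial (Fin n) R} (hf : f ∈ puncturedSet S E ψ t) :
    f ∈ powIdeal t (multisetPoly S ψ) +
      powIdeal (t - 1) (multisetPoly S ψ) * Ideal.span {∏ i, quotPoly S E ψ i} := by
  obtain ⟨c, hcf, hc⟩ := exists_newton_expansion hE hψ hD hS hf
  rw [hcf]
  refine Ideal.sum_mem _ fun κ hκ => ?_
  rw [smul_eq_C_mul]
  refine Ideal.mul_mem_left _ _ ?_
  rcases (hc κ hκ).2 with h | ⟨h, h'⟩
  · exact Ideal.mem_sup_left (newtonBasis_rootSeq_mem_powIdeal hE h)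
  · refine Ideal.mem_sup_right ?_
    have hdvd : (∏ i, multisetPoly S ψ i ^ (κ i / ∑ u ∈ S i, ψ i u)) * ∏ i, quotPoly S E ψ i ∣
        newtonBasis (rootSeq S E ψ) κ := by
      rw [← Finset.prod_mul_distrib]
      exact Finset.prod_dvd_prod_of_dvd _ _
        fun i _ => pow_mul_quotPoly_dvd_aeval_newtonPoly hE (h' i)
    refine Ideal.mem_of_dvd _ hdvd (Ideal.mul_mem_mul ?_ (Ideal.mem_span_singleton_self _))
    rw [← h]
    exact prod_pow_mem_powIdeal _ _

/-- The punctured expansion with every `E_i` empty: the second kind of index would need a remainder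
of at least `d_i`. Having `n > 0` makes the product of empty sets empty. -/
theorem mem_powIdeal_iff (hn : 0 < n) (hψ : ∀ k, ∀ u ∈ S k, 0 < ψ k u)
    (hD : ∀ k, ConditionD (S k : Set R)) {t : ℕ} {f : MvPolynomial (Fin n) R} :
    f ∈ powIdeal t (multisetPoly S ψ) ↔
      ∀ a : Fin n → R, (∀ i, a i ∈ S i) → VanishesTo ψ t a f := by
  refine ⟨fun hf a ha => vanishesTo_of_mem_powIdeal
    (fun i => vanishesTo_one_multisetPoly (ha i) (hψ i _ (ha i))) hf, fun hf => ?_⟩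
  by_cases hS : ∀ i, (S i).Nonempty
  · have hE : ∀ k, (fun _ : Fin n => (∅ : Finset R)) k ⊆ S k := fun k => Finset.empty_subset _
    have hQ : f ∈ puncturedSet S (fun _ => ∅) ψ t :=
      ⟨fun a ha _ => hf a ha, fun a ha => absurd (ha ⟨0, hn⟩) (Finset.notMem_empty _)⟩
    obtain ⟨c, hcf, hc⟩ := exists_newton_expansion hE hψ hD hS hQ
    rw [hcf]
    refine Ideal.sum_mem _ fun κ hκ => ?_
    rw [smul_eq_C_mul]
    refine Ideal.mul_mem_left _ _ ?_
    rcases (hc κ hκ).2 with h | ⟨_, h⟩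
    · exact newtonBasis_rootSeq_mem_powIdeal hE h
    · have hpos : 0 < ∑ u ∈ S ⟨0, hn⟩, ψ ⟨0, hn⟩ u := Finset.sum_pos (hψ _) (hS _)
      have h0 := h ⟨0, hn⟩
      rw [Finset.sdiff_empty] at h0
      exact absurd (Nat.mod_lt _ hpos) (not_lt.2 h0)
  · push Not at hS
    obtain ⟨i, hi⟩ := hS
    rw [powIdeal_eq_top (i := i) (by simp [multisetPoly, hi])]
    trivial

end Punctured

/-! ### The four assertions -/

section Main

variable {R : Type*} [CommRing R] [DecidableEq R] {n : ℕ} {S E : Fin n → Finset R}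
  {ψ : Fin n → R → ℕ}

theorem VanishesTo.of_mem_powIdeal_multisetPoly {A : Fin n → Finset R}
    (hψ : ∀ k, ∀ u ∈ A k, 0 < ψ k u) {a : Fin n → R} (ha : ∀ i, a i ∈ A i) {t : ℕ}
    {f : MvPolynomial (Fin n) R} (hf : f ∈ powIdeal t (multisetPoly A ψ)) :
    VanishesTo ψ t a f :=
  vanishesTo_of_mem_powIdeal (fun i => vanishesTo_one_multisetPoly (ha i) (hψ i _ (ha i))) hf

theorem powIdeal_le_puncturedSet (hE : ∀ k, E k ⊆ S k) (hψ : ∀ k, ∀ u ∈ S k, 0 < ψ k u) {t : ℕ}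
    {f : MvPolynomial (Fin n) R} (hf : f ∈ powIdeal t (multisetPoly S ψ)) :
    f ∈ puncturedSet S E ψ t :=
  ⟨fun _ ha _ => .of_mem_powIdeal_multisetPoly hψ ha hf,
    fun _ ha => (VanishesTo.of_mem_powIdeal_multisetPoly hψ (fun i => hE i (ha i)) hf).mono
      (Nat.sub_le _ _)⟩

theorem mul_prod_quotPoly_mem_puncturedSet (hE : ∀ k, E k ⊆ S k)
    (hψ : ∀ k, ∀ u ∈ S k, 0 < ψ k u) {t : ℕ} (ht : 0 < t) {p : MvPolynomial (Fin n) R}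
    (hp : p ∈ powIdeal (t - 1) (multisetPoly S ψ)) :
    p * ∏ i, quotPoly S E ψ i ∈ puncturedSet S E ψ t := by
  constructor
  · intro a ha hne
    push Not at hne
    obtain ⟨i, hi⟩ := hne
    have h1 : VanishesTo ψ 1 a (∏ i, quotPoly S E ψ i) := by
      rw [← Finset.mul_prod_erase _ _ (Finset.mem_univ i)]
      exact (vanishesTo_one_multisetPoly (Finset.mem_sdiff.2 ⟨ha i, hi⟩)
        (hψ i _ (ha i))).mul_right _
    have h2 := (VanishesTo.of_mem_powIdeal_multisetPoly hψ ha hp).mul h1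
    rwa [Nat.sub_add_cancel ht] at h2
  · intro a ha
    exact (VanishesTo.of_mem_powIdeal_multisetPoly hψ (fun i => hE i (ha i)) hp).mul_right _

theorem puncturedSet_eq_sup (hE : ∀ k, E k ⊆ S k) (hψ : ∀ k, ∀ u ∈ S k, 0 < ψ k u)
    (hD : ∀ k, ConditionD (S k : Set R)) {t : ℕ} (ht : 0 < t) :
    puncturedSet S E ψ t = ((powIdeal t (multisetPoly S ψ) +
      powIdeal (t - 1) (multisetPoly S ψ) * Ideal.span {∏ i, quotPoly S E ψ i} :
        Ideal (MvPolynomial (Fin n) R)) : Set (MvPolynomial (Fin n) R)) := by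
  ext f
  constructor
  · intro hf
    by_cases hS : ∀ i, (S i).Nonempty
    · exact mem_sup_of_mem_puncturedSet hE hψ hD hS hf
    · push Not at hS
      obtain ⟨i, hi⟩ := hS
      rw [powIdeal_eq_top (i := i) (t := t) (by simp [multisetPoly, hi])]
      exact Ideal.mem_sup_left trivial
  · intro hf
    obtain ⟨p, hp, r, hr, rfl⟩ := Submodule.mem_sup.1 hf
    obtain ⟨s, hs, rfl⟩ := Ideal.mem_mul_span_singleton.1 hr
    have h1 := powIdeal_le_puncturedSet hE hψ hp
    have h2 := mul_prod_quotPoly_mem_puncturedSet hE hψ ht hs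
    exact ⟨fun a ha hne => (h1.1 a ha hne).add (h2.1 a ha hne),
      fun a ha => (h1.2 a ha).add (h2.2 a ha)⟩

theorem update_multisetPoly (m : Fin n) :
    Function.update (multisetPoly S ψ) m (quotPoly S E ψ m) =
      multisetPoly (Function.update S m (S m \ E m)) ψ := by
  ext1 k
  by_cases hk : k = m
  · subst hk; simp [quotPoly, multisetPoly]
  · simp [multisetPoly, Function.update_of_ne hk]

theorem update_sdiff_subset {R : Type*} [DecidableEq R] {S E : Fin n → Finset R} (m k : Fin n) : Function.update S m (S m \ E m) k ⊆ S k := by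
  by_cases hk : k = m
  · subst hk; simp
  · rw [Function.update_of_ne hk]

theorem ConditionD.mono {R : Type*} [CommRing R] {X Y : Set R} (hY : ConditionD Y) (h : X ⊆ Y) : ConditionD X :=
  fun a ha b hb hab => hY a (h ha) b (h hb) hab

/-- The points of `∏ S_i` outside `∏ E_i` are the union over `m` of the grids with `S_m` replaced by
`S_m \ E_m`; `g_m / h_m` is the `m`-th polynomial of that grid. The Nullstellensatz applies to each
grid and to `∏ E_i`. -/
theorem puncturedSet_eq_iInf (hn : 0 < n) (hE : ∀ k, E k ⊆ S k)
    (hψ : ∀ k, ∀ u ∈ S k, 0 < ψ k u) (hD : ∀ k, ConditionD (S k : Set R)) (t : ℕ) :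
    puncturedSet S E ψ t =
      (((⨅ m : Fin n, powIdeal t (Function.update (multisetPoly S ψ) m (quotPoly S E ψ m))) ⊓
        powIdeal (t - 1) (multisetPoly E ψ) : Ideal (MvPolynomial (Fin n) R)) :
          Set (MvPolynomial (Fin n) R)) := by
  ext f
  rw [SetLike.mem_coe, Submodule.mem_inf, Submodule.mem_iInf,
    mem_powIdeal_iff hn (fun k u hu => hψ k u (hE k hu))
      (fun k => (hD k).mono (Finset.coe_subset.2 (hE k)))]
  simp only [update_multisetPoly]
  refine and_congr ?_ Iff.rfl
  have hmem : ∀ m, f ∈ powIdeal t (multisetPoly (Function.update S m (S m \ E m)) ψ) ↔ _ :=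
    fun m => mem_powIdeal_iff hn (fun k u hu => hψ k u (update_sdiff_subset m k hu))
      (fun k => (hD k).mono (Finset.coe_subset.2 (update_sdiff_subset m k)))
  simp only [hmem]
  constructor
  · intro h m a ha
    refine h a (fun i => update_sdiff_subset m i (ha i)) fun h' => ?_
    have := ha m
    rw [Function.update_self] at this
    exact (Finset.mem_sdiff.1 this).2 (h' m)
  · intro h a ha hne
    push Not at hne
    obtain ⟨m, hm⟩ := hne
    refine h m a fun i => ?_
    by_cases hi : i = m
    · subst hi
      rw [Function.update_self]
      exact Finset.mem_sdiff.2 ⟨ha i, hm⟩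
    · rw [Function.update_of_ne hi]
      exact ha i

theorem notMem_powIdeal_iff (hn : 0 < n) (hE : ∀ k, E k ⊆ S k)
    (hψ : ∀ k, ∀ u ∈ S k, 0 < ψ k u) (hD : ∀ k, ConditionD (S k : Set R)) {t : ℕ} (ht : 0 < t)
    {f : MvPolynomial (Fin n) R} (hf : f ∈ puncturedSet S E ψ t) :
    f ∉ powIdeal t (multisetPoly S ψ) ↔
      ∃ (v : Fin n → R) (γ : Fin n →₀ ℕ), (∀ i, v i ∈ E i) ∧ weightedOrder ψ v γ = t - 1 ∧
        coeff γ (shift v f) ≠ 0 := by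
  rw [mem_powIdeal_iff hn hψ hD]
  constructor
  · intro h
    simp only [VanishesTo, not_forall] at h
    obtain ⟨a, ha, β, hβ, hne⟩ := h
    have haE : ∀ i, a i ∈ E i := by
      by_contra hnot
      exact hne (hf.1 a ha hnot β hβ)
    refine ⟨a, β, haE, ?_, hne⟩
    by_contra hne'
    exact hne (hf.2 a haE β (by omega))
  · rintro ⟨v, γ, hv, hw, hne⟩ h
    exact hne (h v (fun i => hE i (hv i)) γ (by omega))

/-- The product is itself a Newton basis element, and its own detecting coefficient, of weighted
order `∑ γ_i < t`, is nonzero. -/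
theorem prod_pow_mul_quotPoly_notMem_powIdeal [Nontrivial R] (hE : ∀ k, E k ⊆ S k)
    (hψ : ∀ k, ∀ u ∈ S k, 0 < ψ k u) (hD : ∀ k, ConditionD (S k : Set R))
    (hne : ∀ i, (E i).Nonempty) (γ : Fin n →₀ ℕ) {t : ℕ} (ht : ∑ i, γ i < t) :
    (∏ i, multisetPoly S ψ i ^ γ i) * ∏ i, quotPoly S E ψ i ∉
      powIdeal t (multisetPoly S ψ) := by
  have hS : ∀ i, (S i).Nonempty := fun i => (hne i).mono (hE i)
  have hlt : ∀ i, ∑ u ∈ S i \ E i, ψ i u < ∑ u ∈ S i, ψ i u := by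
    intro i
    rw [← Finset.sum_sdiff (hE i)]
    exact Nat.lt_add_of_pos_right (Finset.sum_pos (fun u hu => hψ i u (hE i hu)) (hne i))
  -- In direction `i`: `γ i` full periods, then the block of `g_i / h_i`, shorter than a period
  -- because `E i` is nonempty.
  let κ : Fin n →₀ ℕ := Finsupp.equivFunOnFinite.symm fun i =>
    γ i * (∑ u ∈ S i, ψ i u) + ∑ u ∈ S i \ E i, ψ i u
  have hκ : ∀ i, κ i = γ i * (∑ u ∈ S i, ψ i u) + ∑ u ∈ S i \ E i, ψ i u := fun _ => rfl
  have heq : (∏ i, multisetPoly S ψ i ^ γ i) * ∏ i, quotPoly S E ψ i =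
      newtonBasis (rootSeq S E ψ) κ := by
    rw [newtonBasis, ← Finset.prod_mul_distrib]
    refine Finset.prod_congr rfl fun i _ => ?_
    rw [hκ, aeval_newtonPoly_rootSeq hE, aeval_newtonPoly_rootSeq_sdiff]
  have hord := weightedOrder_visitExponent hE hψ hS κ
  have hdiv : ∀ i, κ i / ∑ u ∈ S i, ψ i u = γ i := fun i => by
    rw [hκ, mul_comm, Nat.mul_add_div (by have := hlt i; omega), Nat.div_eq_of_lt (hlt i),
      add_zero]
  simp only [hdiv] at hord
  rw [heq]
  intro hmem
  refine nonZeroDivisors.ne_zero (coeff_shift_newtonBasis_self hD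
    (fun i => rootSeq_mem hE hψ (hS i)) κ) ?_
  exact VanishesTo.of_mem_powIdeal_multisetPoly hψ (fun i => rootSeq_mem hE hψ (hS i) _) hmem _
    (by rw [hord]; exact ht)

/-- Outside the ideal, some index of the expansion has order `t - 1` with large remainders; its
degree obeys the bound and is at most that of `f`. -/
theorem le_totalDegree_of_notMem_powIdeal (hE : ∀ k, E k ⊆ S k)
    (hψ : ∀ k, ∀ u ∈ S k, 0 < ψ k u) (hD : ∀ k, ConditionD (S k : Set R))
    (hS : ∀ i, (S i).Nonempty) {t e : ℕ} (he : ∀ i, e ≤ ∑ u ∈ S i, ψ i u)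
    {f : MvPolynomial (Fin n) R} (hf : f ∈ puncturedSet S E ψ t)
    (hnot : f ∉ powIdeal t (multisetPoly S ψ)) :
    (t - 1) * e + ∑ i, ∑ u ∈ S i \ E i, ψ i u ≤ f.totalDegree := by
  obtain ⟨c, hcf, hc⟩ := exists_newton_expansion hE hψ hD hS hf
  have : ∃ κ ∈ c.support, ¬ t ≤ ∑ i, κ i / ∑ u ∈ S i, ψ i u := by
    by_contra! hall
    refine hnot ?_
    rw [hcf]
    refine Ideal.sum_mem _ fun κ hκ => ?_
    rw [smul_eq_C_mul]
    exact Ideal.mul_mem_left _ _ (newtonBasis_rootSeq_mem_powIdeal hE (hall κ hκ))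
  obtain ⟨κ, hκ, hlt⟩ := this
  obtain ⟨hdeg, hidx⟩ := hc κ hκ
  obtain ⟨h1, h2⟩ := hidx.resolve_left hlt
  refine le_trans ?_ hdeg
  rw [← h1, Finset.sum_mul, ← Finset.sum_add_distrib, Finsupp.degree_eq_sum]
  refine Finset.sum_le_sum fun i _ => ?_
  calc _ ≤ κ i / (∑ u ∈ S i, ψ i u) * (∑ u ∈ S i, ψ i u) + κ i % ∑ u ∈ S i, ψ i u :=
        Nat.add_le_add (Nat.mul_le_mul_left _ (he i)) (h2 i)
    _ = κ i := Nat.div_add_mod' _ _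

theorem totalDegree_multisetPoly_le {R : Type*} [CommRing R] {ψ : Fin n → R → ℕ}
    (A : Fin n → Finset R) (k : Fin n) :
    (multisetPoly A ψ k).totalDegree ≤ ∑ u ∈ A k, ψ k u := by
  rcases subsingleton_or_nontrivial R with h | h
  · rw [Subsingleton.elim (multisetPoly A ψ k) 0, totalDegree_zero]
    exact Nat.zero_le _
  refine (totalDegree_finsetProd _ _).trans (Finset.sum_le_sum fun u _ => ?_)
  refine (totalDegree_pow _ _).trans ?_
  have : (X k - C u : MvPolynomial (Fin n) R).totalDegree ≤ 1 := by
    rw [← totalDegree_X (R := R) k]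
    exact totalDegree_sub_C_le _ _
  simpa using Nat.mul_le_mul_left (ψ k u) this

end Main

end PuncturedNull

open PuncturedNull in
theorem corollary5p2 {R : Type*} [CommRing R] [Nontrivial R] [DecidableEq R]
    {n : ℕ} (hn : 0 < n)
    (S E : Fin n → Finset R) (hE : ∀ k, E k ⊆ S k)
    (ψ : Fin n → R → ℕ) (hψ : ∀ k, ∀ u ∈ S k, 0 < ψ k u)
    (t : ℕ) (ht : 0 < t)
    (hD : ∀ k, ConditionD (S k : Set R))
    (e : ℕ) (he : IsLeast (Set.range fun k => ∑ u ∈ S k, ψ k u) e)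
    (g h q : Fin n → MvPolynomial (Fin n) R)
    (hg : g = multisetPoly S ψ) (hh : h = multisetPoly E ψ) (hq : q = quotPoly S E ψ)
    (Q : Set (MvPolynomial (Fin n) R)) (hQ : Q = puncturedSet S E ψ t) :
    Q = (((⨅ m : Fin n, powIdeal t (Function.update g m (q m))) ⊓ powIdeal (t - 1) h :
        Ideal (MvPolynomial (Fin n) R)) : Set (MvPolynomial (Fin n) R)) ∧
    Q = ((powIdeal t g + powIdeal (t - 1) g * Ideal.span {∏ i, q i} :
        Ideal (MvPolynomial (Fin n) R)) : Set (MvPolynomial (Fin n) R)) ∧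
    (∀ f ∈ Q, f ∉ powIdeal t g ↔
      ∃ (v : Fin n → R) (γ : Fin n →₀ ℕ), (∀ i, v i ∈ E i) ∧ weightedOrder ψ v γ = t - 1 ∧
        MvPolynomial.coeff γ (shift v f) ≠ 0) ∧
    ((∀ i, (E i).Nonempty) →
      (∀ γ : Fin n →₀ ℕ, ∑ i, γ i = t - 1 →
        (∏ i, g i ^ γ i) * ∏ i, q i ∈ Q ∧ (∏ i, g i ^ γ i) * ∏ i, q i ∉ powIdeal t g) ∧
      IsLeast {d : ℕ | ∃ f ∈ Q, f ∉ powIdeal t g ∧ f.totalDegree = d}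
        ((t - 1) * e + ∑ i, ∑ u ∈ S i \ E i, ψ i u)) := by
  subst hg hh hq hQ
  refine ⟨puncturedSet_eq_iInf hn hE hψ hD t, puncturedSet_eq_sup hE hψ hD ht,
    fun f hf => notMem_powIdeal_iff hn hE hψ hD ht hf, fun hne => ?_⟩
  have hS : ∀ i, (S i).Nonempty := fun i => (hne i).mono (hE i)
  have hmem : ∀ γ : Fin n →₀ ℕ, ∑ i, γ i = t - 1 →
      (∏ i, multisetPoly S ψ i ^ γ i) * ∏ i, quotPoly S E ψ i ∈ puncturedSet S E ψ t ∧
      (∏ i, multisetPoly S ψ i ^ γ i) * ∏ i, quotPoly S E ψ i ∉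
        powIdeal t (multisetPoly S ψ) := fun γ hγ =>
    ⟨mul_prod_quotPoly_mem_puncturedSet hE hψ ht (hγ ▸ prod_pow_mem_powIdeal _ _),
      prod_pow_mul_quotPoly_notMem_powIdeal hE hψ hD hne γ (by omega)⟩
  have hle : ∀ i, e ≤ ∑ u ∈ S i, ψ i u := fun i => he.2 ⟨i, rfl⟩
  refine ⟨hmem, ?_, ?_⟩
  · obtain ⟨k, hk⟩ := he.1
    -- The minimum is attained by putting the whole exponent `t - 1` on a `g_k` of least degree.
    obtain ⟨h1, h2⟩ := hmem (Finsupp.single k (t - 1)) 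
      (by rw [← Finsupp.degree_eq_sum, Finsupp.degree_single])
    refine ⟨_, h1, h2, le_antisymm ?_ (le_totalDegree_of_notMem_powIdeal hE hψ hD hS hle h1 h2)⟩
    refine (MvPolynomial.totalDegree_mul _ _).trans (Nat.add_le_add ?_ ?_)
    · rw [Finset.prod_eq_single k (fun j _ hj => by rw [Finsupp.single_eq_of_ne hj, pow_zero])
        (fun hk => absurd (Finset.mem_univ k) hk), Finsupp.single_eq_same]
      refine (MvPolynomial.totalDegree_pow _ _).trans (Nat.mul_le_mul_left _ ?_)
      exact (totalDegree_multisetPoly_le S k).trans hk.le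
    · exact (MvPolynomial.totalDegree_finsetProd _ _).trans
        (Finset.sum_le_sum fun i _ => totalDegree_multisetPoly_le _ i)
  · rintro d ⟨f, hf, hnot, rfl⟩
    exact le_totalDegree_of_notMem_powIdeal hE hψ hD hS hle hf hnot
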